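/- For $x\in[0,1]$ let $T$ be the Gauss map, $T(x)=\frac1x-\lfloor\frac1x\rfloor$ for $x\neq0$ and $T(0)=0$. For a finite string $w$ of positive integers let $C_w$ be the set of all $x\in[0,1]$ whose continued fraction expansion $[0;a_1,a_2,\dots]$ begins with $w$, where $a_{i+1}=\lfloor 1/T^i x\rfloor$ as long as $T^ix\neq0$. Let $\gamma(A)=\frac1{\ln 2}\int_A\frac{dx}{1+x}$ (for Borel $A\subseteq[0,1]$) be the Gauss measure. **Theorem (Converse to Pillai's theorem for continued fractions).** Let $x\in(0,1)$. Suppose that for every $k\ge1$ and every string $s$ of $k$ positive integers $$\lim_{n\to\infty}\frac{|\{i\in\mathbb Z : 0\le i\le n,\ T^{i}x\in C_s\}|}{n}=\gamma(C_s).$$ Then for every $m\ge1$ and every string $t$ of $m$ positive integers $$\lim_{n\to\infty}\frac{|\{i\in\mathbb Z : 0\le i\le n/m,\ T^{mi}x\in C_t\}|}{n/m}=\gamma(C_t).$$ -/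

import Mathlib

open MeasureTheory Filter Topology

noncomputable section

/-- The Gauss map `x ↦ 1/x - ⌊1/x⌋`, with the value `0` at `0`. -/
def gaussMap (x : ℝ) : ℝ := Int.fract x⁻¹

/-- The partial quotient `a_{i+1} = ⌊1 / T^i x⌋` of `x = [0; a₁, a₂, …]` in `[0, 1]`. If the expansion
is finite, the value past its end is `0`, which is not a partial quotient. -/
def cfDigit (x : ℝ) (i : ℕ) : ℕ := ⌊(gaussMap^[i] x)⁻¹⌋₊

/-- The cylinder `C_w` of the reals in `[0, 1]` whose continued fraction expansion has the
string `w` of positive integers as a prefix. -/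
def cfCylinder (w : List ℕ+) : Set ℝ :=
  {x | x ∈ Set.Icc 0 1 ∧ ∀ (i : ℕ) (hi : i < w.length), cfDigit x i = (w[i] : ℕ)}

/-- The Gauss measure `γ(A) = (1 / ln 2) ∫_A dx / (1 + x)` on `[0, 1]`. -/
def gaussMeasure : Measure ℝ :=
  (volume.restrict (Set.Icc 0 1)).withDensity
    fun x => ENNReal.ofReal (1 / Real.log 2 * (1 / (1 + x)))

/-- The number of `i` with `0 ≤ i ≤ n` and `T^i x ∈ C_s`: all positions are counted, so
occurrences of `s` may overlap. -/
def slidingCount (x : ℝ) (s : List ℕ+) (n : ℕ) : ℕ :=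
  {i : ℕ | i ≤ n ∧ gaussMap^[i] x ∈ cfCylinder s}.ncard

/-- The number of `i` with `0 ≤ i ≤ n / m` and `T^{m i} x ∈ C_t`, where `m` is the length
of `t`: only the disjoint blocks at the positions `0, m, 2m, …` are counted. -/
def disjointCount (x : ℝ) (t : List ℕ+) (n : ℕ) : ℕ :=
  {i : ℕ | (i : ℝ) ≤ (n : ℝ) / (t.length : ℝ) ∧
    gaussMap^[t.length * i] x ∈ cfCylinder t}.ncard

end

/-! Let f(i) be the indicator of T^i x ∈ C_t, with mean p = γ(C_t), and let m be the length of t.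
The claim is that f keeps its mean along the multiples of m. Normality determines every correlation
of f: the set C_t ∩ T^{-md} C_t depends on finitely many digits, so up to a null set it is a
countable union of cylinders. The cylinder frequencies converge to a probability measure, so no mass
escapes and the frequency of the union is its Gauss measure (`tendsto_cesaroAvg_cfPrefix`). Mixing
of T makes this measure tend to p² as d → ∞ (`tendsto_gaussMeasure_cfCylinder_inter`).

The rest is a van der Corput argument (`tendsto_cesaroAvg_mul_zero`). Put g = f - p and let G be the
sum of K translates of g by widely spaced multiples of m. Decorrelation makes the mean square of G
over all integers small compared with K². Passing to the multiples of m costs at most a factor m,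
and there the mean of G is asymptotically K times that of g; so g has mean 0 there.

Mixing comes from a spectral gap: the transfer operator contracts the Lipschitz seminorm by 7/8, so
correlations with a Lipschitz function decay exponentially. A cylinder enters through its image
under T^{|w|}, which has a Lipschitz density. -/

/-! ### Lipschitz contraction of the transfer operator -/

/-- The inverse branch `x ↦ 1 / (k + 1 + x)` of the Gauss map. -/
noncomputable def gaussBranch (k : ℕ) (x : ℝ) : ℝ := (k + 1 + x)⁻¹

/-- The weight of the branch `k` in the transfer operator of the Gauss map with respect to the Gauss measure. -/
noncomputable def gaussWeight (k : ℕ) (x : ℝ) : ℝ := (1 + x) / ((k + 1 + x) * (k + 2 + x))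

/-- The transfer operator of the Gauss map with respect to the Gauss measure. -/
noncomputable def gaussTransfer (h : ℝ → ℝ) (x : ℝ) : ℝ :=
  ∑' k : ℕ, gaussWeight k x * h (gaussBranch k x)

/-- The tail sum of the branch weights from `k` on. -/
noncomputable def gaussTail (k : ℕ) (x : ℝ) : ℝ := (1 + x) / (k + 1 + x)

/-- `h` is Lipschitz on the unit interval with constant `L`. -/
def LipOnUnit (L : ℝ) (h : ℝ → ℝ) : Prop :=
  ∀ x ∈ Set.Icc (0 : ℝ) 1, ∀ y ∈ Set.Icc (0 : ℝ) 1, |h x - h y| ≤ L * |x - y|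

lemma LipOnUnit.nonneg {L : ℝ} {h : ℝ → ℝ} (hh : LipOnUnit L h) : 0 ≤ L := by
  have := hh 1 (by simp) 0 (by simp)
  have h0 := abs_nonneg (h 1 - h 0)
  norm_num at this
  linarith

lemma LipOnUnit.continuousOn {L : ℝ} {h : ℝ → ℝ} (hh : LipOnUnit L h) :
    ContinuousOn h (Set.Icc 0 1) := by
  have : LipschitzOnWith (Real.toNNReal L) h (Set.Icc 0 1) := by
    refine LipschitzOnWith.of_dist_le_mul fun x hx y hy => ?_
    rw [Real.dist_eq, Real.dist_eq, Real.coe_toNNReal _ hh.nonneg]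
    exact hh x hx y hy
  exact this.continuousOn

lemma LipOnUnit.abs_le {L : ℝ} {h : ℝ → ℝ} (hh : LipOnUnit L h) {x : ℝ}
    (hx : x ∈ Set.Icc (0 : ℝ) 1) : |h x| ≤ |h 0| + L := by
  have h1 := hh x hx 0 (by simp)
  have h2 : |x - 0| ≤ 1 := by rw [sub_zero, abs_of_nonneg hx.1]; exact hx.2
  have h3 := abs_sub_abs_le_abs_sub (h x) (h 0)
  nlinarith [hh.nonneg]

lemma gaussBranch_mem (k : ℕ) {x : ℝ} (hx : x ∈ Set.Icc (0 : ℝ) 1) :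
    gaussBranch k x ∈ Set.Icc (0 : ℝ) 1 := by
  have := hx.1
  unfold gaussBranch
  refine ⟨by positivity, inv_le_one_of_one_le₀ ?_⟩
  have : (0 : ℝ) ≤ k := k.cast_nonneg
  linarith

lemma gaussWeight_nonneg (k : ℕ) {x : ℝ} (hx : 0 ≤ x) : 0 ≤ gaussWeight k x := by
  unfold gaussWeight; positivity

lemma gaussWeight_eq_sub (k : ℕ) {x : ℝ} (hx : 0 ≤ x) :
    gaussWeight k x = gaussTail k x - gaussTail (k + 1) x := by
  unfold gaussWeight gaussTail
  have h1 : (k : ℝ) + 1 + x ≠ 0 := by positivity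
  have h2 : (k : ℝ) + 2 + x ≠ 0 := by positivity
  have h3 : (k : ℝ) + 1 + 1 + x ≠ 0 := by positivity
  push_cast
  field_simp
  ring

lemma sum_gaussWeight (n : ℕ) {x : ℝ} (hx : 0 ≤ x) :
    ∑ k ∈ Finset.range n, gaussWeight k x = 1 - gaussTail n x := by
  rw [Finset.sum_congr rfl fun k _ => gaussWeight_eq_sub k hx, Finset.sum_range_sub']
  congr 1
  unfold gaussTail
  have h2 : (1 : ℝ) + x ≠ 0 := by positivity
  simp [h2]

lemma tendsto_gaussTail (x : ℝ) : Tendsto (fun k => gaussTail k x) atTop (𝓝 0) := by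
  unfold gaussTail
  refine Tendsto.div_atTop tendsto_const_nhds ?_
  exact tendsto_atTop_add_const_right _ _
    (tendsto_atTop_add_const_right _ _ tendsto_natCast_atTop_atTop)

lemma hasSum_gaussWeight {x : ℝ} (hx : 0 ≤ x) : HasSum (fun k => gaussWeight k x) 1 := by
  rw [hasSum_iff_tendsto_nat_of_nonneg fun k => gaussWeight_nonneg k hx]
  simp_rw [sum_gaussWeight _ hx]
  simpa using (tendsto_gaussTail x).const_sub 1

lemma summable_gaussWeight_mul {h : ℝ → ℝ} {M x : ℝ} (hM : ∀ y ∈ Set.Icc (0 : ℝ) 1, |h y| ≤ M)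
    (hx : x ∈ Set.Icc (0 : ℝ) 1) :
    Summable fun k => gaussWeight k x * h (gaussBranch k x) := by
  refine Summable.of_norm_bounded ((hasSum_gaussWeight hx.1).summable.mul_right M) fun k => ?_
  rw [norm_mul, Real.norm_of_nonneg (gaussWeight_nonneg k hx.1), Real.norm_eq_abs]
  exact mul_le_mul_of_nonneg_left (hM _ (gaussBranch_mem k hx)) (gaussWeight_nonneg k hx.1)

lemma abs_gaussBranch_sub_le (k : ℕ) {x y : ℝ} (hx : 0 ≤ x) (hy : 0 ≤ y) :
    |gaussBranch k x - gaussBranch k y| ≤ |x - y| / ((k : ℝ) + 1) ^ 2 := by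
  unfold gaussBranch
  have h1 : (0 : ℝ) < k + 1 + x := by positivity
  have h2 : (0 : ℝ) < k + 1 + y := by positivity
  rw [inv_sub_inv h1.ne' h2.ne', abs_div, abs_of_pos (mul_pos h1 h2), abs_sub_comm x y]
  rw [show (k : ℝ) + 1 + y - (k + 1 + x) = y - x by ring]
  refine div_le_div_of_nonneg_left (abs_nonneg _) (by positivity) ?_
  nlinarith [mul_nonneg hx hy, k.cast_nonneg (α := ℝ)]

lemma abs_gaussTail_sub_le (k : ℕ) {x y : ℝ} (hx : 0 ≤ x) (hy : 0 ≤ y) :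
    |gaussTail k x - gaussTail k y| ≤ |x - y| * (k / ((k : ℝ) + 1) ^ 2) := by
  have h1 : (0 : ℝ) < k + 1 + x := by positivity
  have h2 : (0 : ℝ) < k + 1 + y := by positivity
  have : gaussTail k x - gaussTail k y = (x - y) * (k / ((k + 1 + x) * (k + 1 + y))) := by
    unfold gaussTail
    field_simp
    ring
  rw [this, abs_mul, abs_of_nonneg (a := (k : ℝ) / _) (by positivity)]
  refine mul_le_mul_of_nonneg_left ?_ (abs_nonneg _)
  refine div_le_div_of_nonneg_left (by positivity) (by positivity) ?_
  nlinarith [mul_nonneg hx hy, k.cast_nonneg (α := ℝ)]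

/-- Branch 0 has weight at most 1/2 and every other branch a factor at most 1/4. As the weights sum
to 1, the total is at most 1/4 + (3/4)(1/2) = 5/8. -/
lemma sum_gaussWeight_div_sq_le (n : ℕ) {x : ℝ} (hx : 0 ≤ x) :
    ∑ k ∈ Finset.range n, gaussWeight k x / ((k : ℝ) + 1) ^ 2 ≤ 5 / 8 := by
  have h0 : gaussWeight 0 x ≤ 1 / 2 := by
    unfold gaussWeight
    push_cast
    rw [div_le_div_iff₀ (by positivity) (by norm_num)]
    nlinarith
  have hle : ∀ k : ℕ, gaussWeight k x / ((k : ℝ) + 1) ^ 2 ≤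
      gaussWeight k x * (1 / 4) + (if k = 0 then 3 / 8 else 0) := by
    intro k
    have hw := gaussWeight_nonneg k hx
    rcases k with _ | k
    · norm_num; linarith
    · rw [if_neg (by omega), add_zero, div_eq_mul_one_div]
      refine mul_le_mul_of_nonneg_left ?_ hw
      refine one_div_le_one_div_of_le (by norm_num) ?_
      push_cast
      nlinarith [k.cast_nonneg (α := ℝ)]
  calc _ ≤ ∑ k ∈ Finset.range n, (gaussWeight k x * (1 / 4) + (if k = 0 then 3 / 8 else 0)) :=
        Finset.sum_le_sum fun k _ => hle k
    _ ≤ 1 * (1 / 4) + 3 / 8 := by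
        rw [Finset.sum_add_distrib, ← Finset.sum_mul]
        refine add_le_add (mul_le_mul_of_nonneg_right ?_ (by norm_num)) ?_
        · exact sum_le_hasSum _ (fun k _ => gaussWeight_nonneg k hx) (hasSum_gaussWeight hx)
        · rw [Finset.sum_ite_eq']
          split_ifs <;> norm_num
    _ = 5 / 8 := by norm_num

/-- Telescoping: (k+2)³ ≥ (k+1)(k+2)(k+3). -/
lemma sum_inv_cube_le (n : ℕ) :
    ∑ k ∈ Finset.range n, 1 / ((k : ℝ) + 2) ^ 3 ≤ 1 / 4 := by
  have key : ∀ n : ℕ, ∑ k ∈ Finset.range n, 1 / ((k : ℝ) + 2) ^ 3 ≤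
      1 / 4 - 1 / (2 * ((n : ℝ) + 1) * (n + 2)) := by
    intro n
    induction n with
    | zero => norm_num
    | succ n ih =>
      rw [Finset.sum_range_succ]
      have : 1 / ((n : ℝ) + 2) ^ 3 ≤
          1 / (2 * ((n : ℝ) + 1) * (n + 2)) - 1 / (2 * ((n : ℝ) + 1 + 1) * (n + 1 + 2)) := by
        have : 1 / (2 * ((n : ℝ) + 1) * (n + 2)) - 1 / (2 * ((n : ℝ) + 1 + 1) * (n + 1 + 2)) =
            1 / (((n : ℝ) + 1) * (n + 2) * (n + 3)) := by
          field_simp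
          ring
        rw [this]
        refine one_div_le_one_div_of_le (by positivity) ?_
        nlinarith [n.cast_nonneg (α := ℝ)]
      push_cast
      linarith
  refine (key n).trans ?_
  have : 0 ≤ 1 / (2 * ((n : ℝ) + 1) * (n + 2)) := by positivity
  linarith

lemma sum_sub_mul_eq (D h : ℕ → ℝ) (hD : D 0 = 0) (n : ℕ) :
    ∑ k ∈ Finset.range n, (D k - D (k + 1)) * h k =
      ∑ k ∈ Finset.range n, D (k + 1) * (h (k + 1) - h k) - D n * h n := by
  induction n with
  | zero => simp [hD]
  | succ n ih => rw [Finset.sum_range_succ, Finset.sum_range_succ, ih]; ring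

/-- Moving the branch points costs 5/8. Moving the weights is summed by parts, so that differences
of tails multiply increments of h between neighbouring branches; these products are at most L|x -
y|/(k+2)³ and cost 1/4. Together 7/8 < 1, plus a boundary term that vanishes as n → ∞. -/
lemma abs_sum_gaussWeight_sub_le {L : ℝ} {h : ℝ → ℝ} (hh : LipOnUnit L h) {x y : ℝ}
    (hx : x ∈ Set.Icc (0 : ℝ) 1) (hy : y ∈ Set.Icc (0 : ℝ) 1) (n : ℕ) :
    |∑ k ∈ Finset.range n, gaussWeight k x * h (gaussBranch k x) -
      ∑ k ∈ Finset.range n, gaussWeight k y * h (gaussBranch k y)| ≤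
      7 / 8 * L * |x - y| + |gaussTail n x - gaussTail n y| * (|h 0| + L) := by
  have hL := hh.nonneg
  have hsplit : ∑ k ∈ Finset.range n, gaussWeight k x * h (gaussBranch k x) -
      ∑ k ∈ Finset.range n, gaussWeight k y * h (gaussBranch k y) =
      ∑ k ∈ Finset.range n, gaussWeight k x * (h (gaussBranch k x) - h (gaussBranch k y)) +
      (∑ k ∈ Finset.range n, (gaussTail (k + 1) x - gaussTail (k + 1) y) *
        (h (gaussBranch (k + 1) y) - h (gaussBranch k y)) -
        (gaussTail n x - gaussTail n y) * h (gaussBranch n y)) := by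
    rw [← sum_sub_mul_eq (fun k => gaussTail k x - gaussTail k y) (fun k => h (gaussBranch k y)),
      ← Finset.sum_add_distrib, ← Finset.sum_sub_distrib]
    · refine Finset.sum_congr rfl fun k _ => ?_
      rw [gaussWeight_eq_sub k hx.1, gaussWeight_eq_sub k hy.1]
      ring
    · have h1 : (1 : ℝ) + x ≠ 0 := by linarith [hx.1]
      have h2 : (1 : ℝ) + y ≠ 0 := by linarith [hy.1]
      simp [gaussTail, h1, h2]
  have hA : |∑ k ∈ Finset.range n, gaussWeight k x * (h (gaussBranch k x) - h (gaussBranch k y))|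
      ≤ L * |x - y| * (5 / 8) := by
    refine (Finset.abs_sum_le_sum_abs _ _).trans ?_
    refine le_trans ?_ (mul_le_mul_of_nonneg_left (sum_gaussWeight_div_sq_le n hx.1)
      (by positivity))
    rw [Finset.mul_sum]
    refine Finset.sum_le_sum fun k _ => ?_
    have hw := gaussWeight_nonneg k hx.1
    rw [abs_mul, abs_of_nonneg hw]
    calc _ ≤ gaussWeight k x * (L * (|x - y| / ((k : ℝ) + 1) ^ 2)) := by
          refine mul_le_mul_of_nonneg_left ?_ hw
          exact (hh _ (gaussBranch_mem k hx) _ (gaussBranch_mem k hy)).trans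
            (mul_le_mul_of_nonneg_left (abs_gaussBranch_sub_le k hx.1 hy.1) hL)
      _ = _ := by ring
  have hB : |∑ k ∈ Finset.range n, (gaussTail (k + 1) x - gaussTail (k + 1) y) *
        (h (gaussBranch (k + 1) y) - h (gaussBranch k y))| ≤ L * |x - y| * (1 / 4) := by
    refine (Finset.abs_sum_le_sum_abs _ _).trans ?_
    refine le_trans ?_ (mul_le_mul_of_nonneg_left (sum_inv_cube_le n) (by positivity))
    rw [Finset.mul_sum]
    refine Finset.sum_le_sum fun k _ => ?_
    rw [abs_mul]
    have h1 := abs_gaussTail_sub_le (k + 1) hx.1 hy.1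
    have h2 : |h (gaussBranch (k + 1) y) - h (gaussBranch k y)| ≤
        L * (1 / (((k : ℝ) + 1) * (k + 2))) := by
      refine (hh _ (gaussBranch_mem _ hy) _ (gaussBranch_mem _ hy)).trans ?_
      refine mul_le_mul_of_nonneg_left ?_ hL
      have hy0 := hy.1
      unfold gaussBranch
      have e1 : (0 : ℝ) < k + 1 + y := by positivity
      have e2 : (0 : ℝ) < k + 1 + 1 + y := by positivity
      push_cast
      rw [inv_sub_inv e2.ne' e1.ne', abs_div, abs_of_pos (mul_pos e2 e1)]
      rw [show (k : ℝ) + 1 + y - (k + 1 + 1 + y) = -1 by ring, abs_neg, abs_one]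
      refine one_div_le_one_div_of_le (by positivity) ?_
      nlinarith [mul_nonneg hy0 hy0, k.cast_nonneg (α := ℝ)]
    calc _ ≤ (|x - y| * ((k + 1 : ℕ) / (((k + 1 : ℕ) : ℝ) + 1) ^ 2)) *
          (L * (1 / (((k : ℝ) + 1) * (k + 2)))) :=
          mul_le_mul h1 h2 (abs_nonneg _) (by positivity)
      _ = _ := by
          push_cast
          field_simp
          ring
  have hC : |(gaussTail n x - gaussTail n y) * h (gaussBranch n y)| ≤
      |gaussTail n x - gaussTail n y| * (|h 0| + L) := by
    rw [abs_mul]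
    exact mul_le_mul_of_nonneg_left (hh.abs_le (gaussBranch_mem n hy)) (abs_nonneg _)
  rw [hsplit]
  refine (abs_add_le _ _).trans ?_
  have := abs_sub (∑ k ∈ Finset.range n, (gaussTail (k + 1) x - gaussTail (k + 1) y) *
        (h (gaussBranch (k + 1) y) - h (gaussBranch k y)))
        ((gaussTail n x - gaussTail n y) * h (gaussBranch n y))
  linarith

/-- The transfer operator contracts the Lipschitz seminorm. -/
lemma LipOnUnit.gaussTransfer {L : ℝ} {h : ℝ → ℝ} (hh : LipOnUnit L h) :
    LipOnUnit (7 / 8 * L) (gaussTransfer h) := by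
  intro x hx y hy
  have hM : ∀ z ∈ Set.Icc (0 : ℝ) 1, |h z| ≤ |h 0| + L := fun z hz => hh.abs_le hz
  have hX := (summable_gaussWeight_mul hM hx).hasSum.tendsto_sum_nat
  have hY := (summable_gaussWeight_mul hM hy).hasSum.tendsto_sum_nat
  have hr : Tendsto (fun n => 7 / 8 * L * |x - y| +
      |gaussTail n x - gaussTail n y| * (|h 0| + L)) atTop (𝓝 (7 / 8 * L * |x - y|)) := by
    have := (((tendsto_gaussTail x).sub (tendsto_gaussTail y)).abs.mul_const
      (|h 0| + L)).const_add (7 / 8 * L * |x - y|)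
    simpa using this
  exact le_of_tendsto_of_tendsto' (hX.sub hY).abs hr
    fun n => abs_sum_gaussWeight_sub_le hh hx hy n

/-- Only the existence of a constant matters here: single terms of the transfer operator serve as
densities of cylinders. -/
lemma LipOnUnit.gaussWeight_mul {L : ℝ} {h : ℝ → ℝ} (hh : LipOnUnit L h) (k : ℕ) :
    ∃ L', LipOnUnit L' (fun x => gaussWeight k x * h (gaussBranch k x)) := by
  refine ⟨L + 2 * (|h 0| + L), fun x hx y hy => ?_⟩
  have hL := hh.nonneg
  have h1 : |gaussWeight k x| ≤ 1 := by
    rw [abs_of_nonneg (gaussWeight_nonneg k hx.1)]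
    exact le_hasSum (hasSum_gaussWeight hx.1) k fun j _ => gaussWeight_nonneg j hx.1
  have h2 : |h (gaussBranch k x) - h (gaussBranch k y)| ≤ L * |x - y| := by
    refine (hh _ (gaussBranch_mem k hx) _ (gaussBranch_mem k hy)).trans ?_
    refine mul_le_mul_of_nonneg_left ?_ hL
    refine (abs_gaussBranch_sub_le k hx.1 hy.1).trans (div_le_self (abs_nonneg _) ?_)
    nlinarith [k.cast_nonneg (α := ℝ)]
  have htail : ∀ j : ℕ, |gaussTail j x - gaussTail j y| ≤ |x - y| := by
    intro j
    refine (abs_gaussTail_sub_le j hx.1 hy.1).trans (mul_le_of_le_one_right (abs_nonneg _) ?_)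
    refine div_le_one_of_le₀ ?_ (by positivity)
    nlinarith [j.cast_nonneg (α := ℝ)]
  have h3 : |gaussWeight k x - gaussWeight k y| ≤ 2 * |x - y| := by
    rw [gaussWeight_eq_sub k hx.1, gaussWeight_eq_sub k hy.1]
    have e : gaussTail k x - gaussTail (k + 1) x - (gaussTail k y - gaussTail (k + 1) y) =
      (gaussTail k x - gaussTail k y) - (gaussTail (k + 1) x - gaussTail (k + 1) y) := by ring
    rw [e]
    refine (abs_sub _ _).trans ?_
    linarith [htail k, htail (k + 1)]
  have h4 := hh.abs_le (gaussBranch_mem k hy)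
  have e : gaussWeight k x * h (gaussBranch k x) - gaussWeight k y * h (gaussBranch k y) =
    gaussWeight k x * (h (gaussBranch k x) - h (gaussBranch k y)) +
    (gaussWeight k x - gaussWeight k y) * h (gaussBranch k y) := by ring
  calc _ ≤ |gaussWeight k x| * |h (gaussBranch k x) - h (gaussBranch k y)| +
      |gaussWeight k x - gaussWeight k y| * |h (gaussBranch k y)| := by
        rw [← abs_mul, ← abs_mul]; simp only [e]; exact abs_add_le _ _
    _ ≤ 1 * (L * |x - y|) + 2 * |x - y| * (|h 0| + L) := by gcongr
    _ ≤ _ := by nlinarith [abs_nonneg (h 0), mul_nonneg (add_nonneg (abs_nonneg (h 0)) hL) (abs_nonneg (x - y))]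

/-! ### The Gauss measure: duality, invariance and decay of correlations -/

lemma measurable_gaussMap : Measurable gaussMap := measurable_fract.comp measurable_inv

lemma measurable_gaussMap_iterate (n : ℕ) : Measurable gaussMap^[n] :=
  measurable_gaussMap.iterate n

lemma gaussMap_mem (x : ℝ) : gaussMap x ∈ Set.Icc (0 : ℝ) 1 :=
  ⟨Int.fract_nonneg _, (Int.fract_lt_one _).le⟩

lemma gaussMap_iterate_mem {x : ℝ} (hx : x ∈ Set.Icc (0 : ℝ) 1) (n : ℕ) :
    gaussMap^[n] x ∈ Set.Icc (0 : ℝ) 1 := by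
  cases n with
  | zero => exact hx
  | succ n => rw [Function.iterate_succ_apply']; exact gaussMap_mem _

lemma measurable_cfDigit (i : ℕ) : Measurable fun x => cfDigit x i :=
  Nat.measurable_floor.comp (measurable_inv.comp (measurable_gaussMap_iterate i))

lemma cfDigit_iterate (x : ℝ) (i j : ℕ) : cfDigit (gaussMap^[i] x) j = cfDigit x (i + j) := by
  unfold cfDigit
  rw [← Function.iterate_add_apply, add_comm]

lemma measurableSet_cfCylinder (w : List ℕ+) : MeasurableSet (cfCylinder w) := by
  have : cfCylinder w = Set.Icc 0 1 ∩
      ⋂ (i : ℕ) (hi : i < w.length), {x | cfDigit x i = (w[i] : ℕ)} := by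
    ext x; simp [cfCylinder]
  rw [this]
  refine measurableSet_Icc.inter (MeasurableSet.iInter fun i => MeasurableSet.iInter fun hi => ?_)
  exact measurable_cfDigit i (measurableSet_singleton _)

instance : IsProbabilityMeasure gaussMeasure := by
  constructor
  have hlog : 0 < Real.log 2 := Real.log_pos (by norm_num)
  have hcont : ContinuousOn (fun x : ℝ => 1 / Real.log 2 * (1 / (1 + x))) (Set.Icc 0 1) := by
    refine continuousOn_const.mul (continuousOn_const.div (by fun_prop) fun x hx => ?_)
    linarith [hx.1]
  have hint : ∫ x in Set.Icc (0 : ℝ) 1, 1 / Real.log 2 * (1 / (1 + x)) = 1 := by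
    rw [integral_Icc_eq_integral_Ioc, ← intervalIntegral.integral_of_le zero_le_one,
      intervalIntegral.integral_const_mul,
      intervalIntegral.integral_comp_add_left (fun x : ℝ => 1 / x) 1, integral_one_div]
    · norm_num [hlog.ne']
    · rw [Set.uIcc_of_le (by norm_num)]
      rintro ⟨h, -⟩
      norm_num at h
  rw [gaussMeasure, withDensity_apply _ MeasurableSet.univ, Measure.restrict_univ,
    ← ofReal_integral_eq_lintegral_ofReal hcont.integrableOn_Icc, hint, ENNReal.ofReal_one]
  filter_upwards [ae_restrict_mem measurableSet_Icc] with x hx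
  have := hx.1
  show 0 ≤ 1 / Real.log 2 * (1 / (1 + x))
  positivity

lemma gaussMeasure_absolutelyContinuous :
    gaussMeasure ≪ volume.restrict (Set.Icc (0 : ℝ) 1) :=
  withDensity_absolutelyContinuous _ _

lemma ae_gaussMeasure_mem_Icc : ∀ᵐ x ∂gaussMeasure, x ∈ Set.Icc (0 : ℝ) 1 :=
  gaussMeasure_absolutelyContinuous.ae_le (ae_restrict_mem measurableSet_Icc)

lemma gaussMeasure_singleton (x : ℝ) : gaussMeasure {x} = 0 := by
  refine gaussMeasure_absolutelyContinuous ?_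
  exact Measure.absolutelyContinuous_of_le Measure.restrict_le_self (by simp)

lemma setIntegral_gaussMeasure {S : Set ℝ} (hS : MeasurableSet S) (f : ℝ → ℝ) :
    ∫ x in S, f x ∂gaussMeasure =
      1 / Real.log 2 * ∫ x in S ∩ Set.Icc 0 1, 1 / (1 + x) * f x := by
  have hlog : 0 < Real.log 2 := Real.log_pos (by norm_num)
  rw [gaussMeasure, setIntegral_withDensity_eq_setIntegral_toReal_smul (by fun_prop)
    (by simp) _ hS, Measure.restrict_restrict hS, ← integral_const_mul]
  refine setIntegral_congr_fun (hS.inter measurableSet_Icc) fun x hx => ?_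
  have := hx.2.1
  rw [ENNReal.toReal_ofReal (by positivity), smul_eq_mul, mul_assoc]

/-- The points of the unit interval whose first partial quotient is `k + 1`. -/
def gaussPiece (k : ℕ) : Set ℝ := {x | x ∈ Set.Icc 0 1 ∧ cfDigit x 0 = k + 1}

lemma measurableSet_gaussPiece (k : ℕ) : MeasurableSet (gaussPiece k) :=
  measurableSet_Icc.inter (measurable_cfDigit 0 (measurableSet_singleton _))

lemma gaussMap_gaussBranch (k : ℕ) {y : ℝ} (hy : y ∈ Set.Ico (0 : ℝ) 1) :
    gaussMap (gaussBranch k y) = y := by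
  rw [gaussMap, gaussBranch, inv_inv, show (k : ℝ) + 1 + y = ((k + 1 : ℕ) : ℝ) + y by push_cast; ring,
    Int.fract_natCast_add, Int.fract_eq_self.2 ⟨hy.1, hy.2⟩]

/-- The interval is half-open because y = 1 would give the digit k + 2. -/
lemma gaussBranch_image (k : ℕ) : gaussBranch k '' Set.Ico 0 1 = gaussPiece k := by
  ext x
  constructor
  · rintro ⟨y, hy, rfl⟩
    refine ⟨gaussBranch_mem k ⟨hy.1, hy.2.le⟩, ?_⟩
    rw [cfDigit, Function.iterate_zero, id, gaussBranch, inv_inv,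
      Nat.floor_eq_iff (by have := hy.1; positivity)]
    push_cast
    exact ⟨by linarith [hy.1], by linarith [hy.2]⟩
  · rintro ⟨hx, h⟩
    rw [cfDigit, Function.iterate_zero, id, Nat.floor_eq_iff (inv_nonneg.2 hx.1)] at h
    push_cast at h
    refine ⟨x⁻¹ - (k + 1), ⟨by linarith, by linarith⟩, ?_⟩
    rw [gaussBranch, add_sub_cancel, inv_inv]

/-- Change of variables along branch k: its weight is the absolute derivative of the branch times
the ratio of the Gauss densities at the branch point and at y. -/
lemma setIntegral_gaussPiece (k : ℕ) (F g : ℝ → ℝ) :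
    ∫ x in gaussPiece k, F x * g (gaussMap x) ∂gaussMeasure =
      ∫ y, gaussWeight k y * F (gaussBranch k y) * g y ∂gaussMeasure := by
  rw [← setIntegral_univ (μ := gaussMeasure), setIntegral_gaussMeasure (measurableSet_gaussPiece k),
    setIntegral_gaussMeasure MeasurableSet.univ, Set.univ_inter,
    Set.inter_eq_left.2 fun x hx => hx.1, ← gaussBranch_image,
    integral_image_eq_integral_abs_deriv_smul (f' := fun y => -1 / ((k : ℝ) + 1 + y) ^ 2)
      measurableSet_Ico, integral_Icc_eq_integral_Ico]
  · congr 1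
    refine setIntegral_congr_fun measurableSet_Ico fun y hy => ?_
    have := hy.1
    rw [gaussMap_gaussBranch k hy, smul_eq_mul, gaussWeight, abs_div, abs_neg, abs_one,
      abs_of_nonneg (by positivity)]
    have e : 1 / (1 + gaussBranch k y) = (k + 1 + y) / (k + 2 + y) := by
      unfold gaussBranch
      field_simp
      ring
    rw [e]
    field_simp
  · intro y hy
    have := hy.1
    have h : HasDerivAt (fun y : ℝ => (k : ℝ) + 1 + y) 1 y := (hasDerivAt_id y).const_add _
    exact (h.fun_inv (by positivity)).hasDerivWithinAt
  · intro a ha b hb hab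
    rw [← gaussMap_gaussBranch k ha, ← gaussMap_gaussBranch k hb, hab]

lemma LipOnUnit.aestronglyMeasurable {L : ℝ} {F : ℝ → ℝ} (hF : LipOnUnit L F) :
    AEStronglyMeasurable F gaussMeasure :=
  (hF.continuousOn.aestronglyMeasurable measurableSet_Icc).mono_ac
    gaussMeasure_absolutelyContinuous

lemma LipOnUnit.integrable_mul {L : ℝ} {F g : ℝ → ℝ} (hF : LipOnUnit L F)
    (hg : Measurable g) (hg1 : ∀ x, |g x| ≤ 1) :
    Integrable (fun x => F x * g x) gaussMeasure := by
  refine Integrable.of_bound (hF.aestronglyMeasurable.mul hg.aestronglyMeasurable) (|F 0| + L) ?_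
  filter_upwards [ae_gaussMeasure_mem_Icc] with x hx
  rw [norm_mul, Real.norm_eq_abs, Real.norm_eq_abs]
  exact (mul_le_of_le_one_right (abs_nonneg _) (hg1 x)).trans (hF.abs_le hx)

lemma LipOnUnit.integrable {L : ℝ} {F : ℝ → ℝ} (hF : LipOnUnit L F) :
    Integrable F gaussMeasure := by
  simpa using hF.integrable_mul (g := fun _ => 1) measurable_const (by simp)

lemma ae_gaussMeasure_mem_iUnion_gaussPiece : ∀ᵐ x ∂gaussMeasure, x ∈ ⋃ k, gaussPiece k := by
  have h0 : ∀ᵐ x ∂gaussMeasure, x ≠ 0 := by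
    rw [ae_iff]; simpa using gaussMeasure_singleton 0
  filter_upwards [ae_gaussMeasure_mem_Icc, h0] with x hx hx0
  have hpos : 0 < x := lt_of_le_of_ne hx.1 hx0.symm
  have h1 : 1 ≤ ⌊x⁻¹⌋₊ := Nat.le_floor (by simpa using (one_le_inv₀ hpos).2 hx.2)
  refine Set.mem_iUnion.2 ⟨⌊x⁻¹⌋₊ - 1, hx, ?_⟩
  rw [cfDigit, Function.iterate_zero, id]
  omega

/-- Duality between the Gauss map and its transfer operator. -/
lemma LipOnUnit.integral_mul_comp {L : ℝ} {F g : ℝ → ℝ} (hF : LipOnUnit L F)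
    (hg : Measurable g) (hg1 : ∀ x, |g x| ≤ 1) :
    ∫ x, F x * g (gaussMap x) ∂gaussMeasure = ∫ x, _root_.gaussTransfer F x * g x ∂gaussMeasure := by
  have hM : ∀ z ∈ Set.Icc (0 : ℝ) 1, |F z| ≤ |F 0| + L := fun z hz => hF.abs_le hz
  have hM0 : 0 ≤ |F 0| + L := add_nonneg (abs_nonneg _) hF.nonneg
  have hint := hF.integrable_mul (hg.comp measurable_gaussMap) fun x => hg1 _
  have hd : Pairwise (Function.onFun Disjoint gaussPiece) := by
    intro i j hij
    refine Set.disjoint_left.2 fun x hi hj => hij ?_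
    have := hi.2.symm.trans hj.2
    omega
  have h1 := hasSum_integral_iUnion measurableSet_gaussPiece hd hint.integrableOn
  rw [Measure.restrict_eq_self_of_ae_mem ae_gaussMeasure_mem_iUnion_gaussPiece] at h1
  have h2 : HasSum (fun k => ∫ y, gaussWeight k y * F (gaussBranch k y) * g y ∂gaussMeasure)
      (∫ x, _root_.gaussTransfer F x * g x ∂gaussMeasure) := by
    refine hasSum_integral_of_dominated_convergence
      (fun k y => gaussWeight k y * (|F 0| + L)) (fun k => ?_) (fun k => ?_) ?_ ?_ ?_
    · obtain ⟨L', h⟩ := hF.gaussWeight_mul k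
      exact h.aestronglyMeasurable.mul hg.aestronglyMeasurable
    · filter_upwards [ae_gaussMeasure_mem_Icc] with y hy
      have hw := gaussWeight_nonneg k hy.1
      rw [norm_mul, norm_mul, Real.norm_eq_abs, Real.norm_eq_abs, Real.norm_eq_abs,
        abs_of_nonneg hw]
      refine (mul_le_of_le_one_right (by positivity) (hg1 y)).trans ?_
      exact mul_le_mul_of_nonneg_left (hM _ (gaussBranch_mem k hy)) hw
    · filter_upwards [ae_gaussMeasure_mem_Icc] with y hy
      exact (hasSum_gaussWeight hy.1).summable.mul_right _
    · refine (integrable_const (|F 0| + L)).congr ?_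
      filter_upwards [ae_gaussMeasure_mem_Icc] with y hy
      rw [tsum_mul_right, (hasSum_gaussWeight hy.1).tsum_eq, one_mul]
    · filter_upwards [ae_gaussMeasure_mem_Icc] with y hy
      exact (summable_gaussWeight_mul hM hy).hasSum.mul_right _
  simp only [Function.comp_apply, setIntegral_gaussPiece] at h1
  exact h1.unique h2

lemma LipOnUnit.integral_gaussTransfer {L : ℝ} {F : ℝ → ℝ} (hF : LipOnUnit L F) :
    ∫ x, _root_.gaussTransfer F x ∂gaussMeasure = ∫ x, F x ∂gaussMeasure := by
  simpa using (hF.integral_mul_comp (g := fun _ => 1) measurable_const (by simp)).symm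

lemma LipOnUnit.abs_sub_integral_le {L : ℝ} {F : ℝ → ℝ} (hF : LipOnUnit L F) {x : ℝ}
    (hx : x ∈ Set.Icc (0 : ℝ) 1) : |F x - ∫ y, F y ∂gaussMeasure| ≤ L := by
  have e : F x - ∫ y, F y ∂gaussMeasure = ∫ y, (F x - F y) ∂gaussMeasure := by
    rw [integral_sub (integrable_const _) hF.integrable]; simp
  rw [e, ← Real.norm_eq_abs]
  refine (norm_integral_le_of_norm_le_const (C := L) ?_).trans (by simp)
  filter_upwards [ae_gaussMeasure_mem_Icc] with y hy
  refine (hF x hx y hy).trans (mul_le_of_le_one_right hF.nonneg ?_)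
  rw [_root_.abs_le]
  exact ⟨by linarith [hx.1, hy.2], by linarith [hx.2, hy.1]⟩

/-- Exponential decay of correlations for the Gauss map. -/
lemma abs_integral_mul_comp_iterate_sub_le {g : ℝ → ℝ} (hg : Measurable g)
    (hg1 : ∀ x, |g x| ≤ 1) (n : ℕ) : ∀ {L : ℝ} {F : ℝ → ℝ}, LipOnUnit L F →
    |∫ x, F x * g (gaussMap^[n] x) ∂gaussMeasure -
      (∫ x, F x ∂gaussMeasure) * ∫ x, g x ∂gaussMeasure| ≤ (7 / 8) ^ n * L := by
  induction n with
  | zero =>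
    intro L F hF
    have hgi : Integrable g gaussMeasure :=
      Integrable.of_bound hg.aestronglyMeasurable 1 (Eventually.of_forall hg1)
    rw [pow_zero, one_mul, ← integral_const_mul, ← integral_sub
      (by simpa using hF.integrable_mul hg hg1) (hgi.const_mul _), ← Real.norm_eq_abs]
    refine (norm_integral_le_of_norm_le_const (C := L) ?_).trans (by simp)
    filter_upwards [ae_gaussMeasure_mem_Icc] with x hx
    rw [Function.iterate_zero, id, ← sub_mul, norm_mul, Real.norm_eq_abs, Real.norm_eq_abs]
    exact (mul_le_of_le_one_right (abs_nonneg _) (hg1 x)).trans (hF.abs_sub_integral_le hx)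
  | succ n ih =>
    intro L F hF
    -- Duality trades one iterate on g for one transfer operator on F, which keeps the integral of F
    -- and gains a factor 7/8.
    simp_rw [Function.iterate_succ_apply]
    rw [hF.integral_mul_comp (g := fun x => g (gaussMap^[n] x))
      (hg.comp (measurable_gaussMap_iterate n)) fun x => hg1 _, ← hF.integral_gaussTransfer]
    refine (ih hF.gaussTransfer).trans (le_of_eq ?_)
    ring

/-- The constant 1 has Lipschitz constant 0, so the correlation bound for one iterate is an
equality. -/
lemma measurePreserving_gaussMap : MeasurePreserving gaussMap gaussMeasure gaussMeasure := by
  refine ⟨measurable_gaussMap, ?_⟩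
  have hone : LipOnUnit 0 (fun _ : ℝ => (1 : ℝ)) := fun x _ y _ => by simp
  have : IsProbabilityMeasure (gaussMeasure.map gaussMap) :=
    Measure.isProbabilityMeasure_map measurable_gaussMap.aemeasurable
  refine Measure.ext fun S hS => ?_
  rw [← measureReal_eq_measureReal_iff]
  have hi : Measurable (S.indicator (1 : ℝ → ℝ)) := measurable_one.indicator hS
  have h := abs_integral_mul_comp_iterate_sub_le hi (fun x => by
    by_cases hx : x ∈ S <;> simp [hx]) 1 hone
  rw [mul_zero] at h
  have h' := sub_eq_zero.1 (abs_nonpos_iff.1 h)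
  simp only [one_mul, Function.iterate_one, integral_const, probReal_univ, smul_eq_mul,
    mul_one] at h'
  rw [integral_indicator_one hS, ← integral_indicator_one hS] at h'
  rw [← integral_indicator_one hS, ← integral_indicator_one hS, ← h',
    integral_map measurable_gaussMap.aemeasurable hi.aestronglyMeasurable]

lemma ae_gaussMeasure_cfDigit_pos : ∀ᵐ x ∂gaussMeasure, ∀ i, 0 < cfDigit x i := by
  rw [ae_all_iff]
  intro i
  have h := (measurePreserving_gaussMap.iterate i).quasiMeasurePreserving.ae
    ae_gaussMeasure_mem_iUnion_gaussPiece
  filter_upwards [h] with x hx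
  obtain ⟨k, -, hk⟩ := Set.mem_iUnion.1 hx
  rw [cfDigit_iterate, add_zero] at hk
  omega

/-! ### Mixing of cylinders -/

lemma mem_cfCylinder_append_singleton {w : List ℕ+} {a : ℕ+} {x : ℝ} :
    x ∈ cfCylinder (w ++ [a]) ↔
      x ∈ cfCylinder w ∧ gaussMap^[w.length] x ∈ gaussPiece (a - 1) := by
  have ha : ((a : ℕ) - 1) + 1 = a := Nat.sub_add_cancel a.pos
  simp only [cfCylinder, gaussPiece, Set.mem_ofPred_eq, cfDigit_iterate, add_zero, ha,
    List.length_append, List.length_singleton]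
  constructor
  · rintro ⟨hx, h⟩
    refine ⟨⟨hx, fun i hi => ?_⟩, gaussMap_iterate_mem hx _, ?_⟩
    · rw [h i (by omega), List.getElem_append_left hi]
    · rw [h w.length (by omega), List.getElem_append_right le_rfl]
      simp
  · rintro ⟨⟨hx, h⟩, -, h'⟩
    refine ⟨hx, fun i hi => ?_⟩
    rcases Nat.lt_succ_iff_lt_or_eq.1 hi with hi' | rfl
    · rw [h i hi', List.getElem_append_left hi']
    · rw [h', List.getElem_append_right le_rfl]
      simp

/-- The Gauss measure restricted to a cylinder, pushed forward by the corresponding iterate of the Gauss map,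
has a Lipschitz density with respect to the Gauss measure. -/
lemma exists_lipOnUnit_density (w : List ℕ+) : ∃ (φ : ℝ → ℝ) (L : ℝ), LipOnUnit L φ ∧
    ∀ g : ℝ → ℝ, Measurable g → (∀ x, |g x| ≤ 1) →
      ∫ x in cfCylinder w, g (gaussMap^[w.length] x) ∂gaussMeasure =
        ∫ x, φ x * g x ∂gaussMeasure := by
  induction w using List.reverseRecOn with
  | nil =>
    refine ⟨fun _ => 1, 0, fun x _ y _ => by simp, fun g _ _ => ?_⟩
    have : cfCylinder [] = Set.Icc 0 1 := by ext x; simp [cfCylinder]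
    rw [this, Measure.restrict_eq_self_of_ae_mem ae_gaussMeasure_mem_Icc]
    simp
  | append_singleton w a ih =>
    obtain ⟨φ, L, hφ, h⟩ := ih
    -- Appending the digit a replaces φ by the single term of its transfer that belongs to the
    -- branch of a, numbered a - 1.
    obtain ⟨L', hL'⟩ := hφ.gaussWeight_mul (a - 1)
    refine ⟨_, L', hL', fun g hg hg1 => ?_⟩
    have hJ := measurableSet_gaussPiece (a - 1)
    have h' := h ((gaussPiece (a - 1)).indicator fun x => g (gaussMap x))
      ((hg.comp measurable_gaussMap).indicator hJ) fun x => by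
        by_cases hx : x ∈ gaussPiece (a - 1) <;> simp [hx, hg1]
    rw [← setIntegral_gaussPiece, ← integral_indicator (measurableSet_cfCylinder _)]
    rw [← integral_indicator (measurableSet_cfCylinder _)] at h'
    rw [← integral_indicator hJ]
    convert h' using 2
    · ext x
      by_cases hw : x ∈ cfCylinder w <;>
        by_cases hp : gaussMap^[w.length] x ∈ gaussPiece (a - 1) <;>
        simp [Set.indicator, mem_cfCylinder_append_singleton, hw, hp,
          Function.iterate_succ_apply']
    · ext x
      by_cases hp : x ∈ gaussPiece (a - 1) <;> simp [hp]

/-- Cylinders are mixing for the Gauss map. -/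
lemma tendsto_gaussMeasure_cfCylinder_inter (w : List ℕ+) {S : Set ℝ} (hS : MeasurableSet S) :
    Tendsto (fun n => gaussMeasure.real (cfCylinder w ∩ gaussMap^[n] ⁻¹' S)) atTop
      (𝓝 (gaussMeasure.real (cfCylinder w) * gaussMeasure.real S)) := by
  obtain ⟨φ, L, hφ, h⟩ := exists_lipOnUnit_density w
  have hi : Measurable (S.indicator (1 : ℝ → ℝ)) := measurable_one.indicator hS
  have hi1 : ∀ x, |S.indicator (1 : ℝ → ℝ) x| ≤ 1 := fun x => by
    by_cases hx : x ∈ S <;> simp [hx]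
  have hφint : ∫ x, φ x ∂gaussMeasure = gaussMeasure.real (cfCylinder w) := by
    simpa using (h (fun _ => 1) measurable_const (by simp)).symm
  -- The density φ describes the cylinder after `w.length` iterates, so decay is counted from there.
  rw [← tendsto_add_atTop_iff_nat w.length, tendsto_iff_norm_sub_tendsto_zero]
  have hlim : Tendsto (fun n : ℕ => ((7 : ℝ) / 8) ^ n * L) atTop (𝓝 0) := by
    simpa using (tendsto_pow_atTop_nhds_zero_of_lt_one (r := (7 : ℝ) / 8)
      (by norm_num) (by norm_num)).mul_const L
  refine squeeze_zero (fun _ => norm_nonneg _) (fun n => ?_) hlim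
  have hb := abs_integral_mul_comp_iterate_sub_le hi hi1 n hφ
  rw [hφint, integral_indicator_one hS,
    ← h (fun x => S.indicator 1 (gaussMap^[n] x))
      (hi.comp (measurable_gaussMap_iterate n)) fun x => hi1 _] at hb
  rw [Real.norm_eq_abs]
  convert hb using 3
  have hm : MeasurableSet (gaussMap^[n + w.length] ⁻¹' S) := measurable_gaussMap_iterate _ hS
  rw [Set.inter_comm, ← measureReal_restrict_apply hm, ← integral_indicator_one hm]
  refine integral_congr_ae (Eventually.of_forall fun x => ?_)
  have e : x ∈ gaussMap^[n + w.length] ⁻¹' S ↔ gaussMap^[n] (gaussMap^[w.length] x) ∈ S := by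
    rw [Set.mem_preimage, Function.iterate_add_apply]
  by_cases hx : gaussMap^[n] (gaussMap^[w.length] x) ∈ S
  · rw [Set.indicator_of_mem (e.2 hx), Pi.one_apply]
    exact (Set.indicator_of_mem hx (1 : ℝ → ℝ)).symm
  · rw [Set.indicator_of_notMem (mt e.1 hx)]
    exact (Set.indicator_of_notMem hx (1 : ℝ → ℝ)).symm

/-! ### Cesàro means along multiples of m -/

/-- The average of the first `n` terms of a sequence. -/
noncomputable def cesaroAvg (u : ℕ → ℝ) (n : ℕ) : ℝ := (∑ i ∈ Finset.range n, u i) / n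

lemma cesaroAvg_sum {ι : Type*} (s : Finset ι) (u : ι → ℕ → ℝ) (n : ℕ) :
    cesaroAvg (fun i => ∑ k ∈ s, u k i) n = ∑ k ∈ s, cesaroAvg (u k) n := by
  unfold cesaroAvg
  rw [Finset.sum_comm, Finset.sum_div]

lemma abs_cesaroAvg_le {u : ℕ → ℝ} (hu : ∀ i, |u i| ≤ 1) (n : ℕ) : |cesaroAvg u n| ≤ 1 := by
  unfold cesaroAvg
  rw [abs_div, Nat.abs_cast]
  refine div_le_one_of_le₀ ((Finset.abs_sum_le_sum_abs _ _).trans ?_) n.cast_nonneg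
  simpa using Finset.sum_le_sum (s := Finset.range n) fun i _ => hu i

lemma tendsto_cesaroAvg_shift_sub {u : ℕ → ℝ} (hu : ∀ i, |u i| ≤ 1) (a : ℕ) :
    Tendsto (fun n => cesaroAvg (fun i => u (i + a)) n - cesaroAvg u n) atTop (𝓝 0) := by
  induction a with
  | zero => simp
  | succ a ih =>
    have h : Tendsto (fun n => cesaroAvg (fun i => u (i + (a + 1))) n -
        cesaroAvg (fun i => u (i + a)) n) atTop (𝓝 0) := by
      refine squeeze_zero_norm (fun n => ?_) (tendsto_const_div_atTop_nhds_zero_nat 2)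
      have e : ∑ i ∈ Finset.range n, u (i + (a + 1)) - ∑ i ∈ Finset.range n, u (i + a) =
          u (n + a) - u a := by
        have h := Finset.sum_range_sub (fun i => u (i + a)) n
        rw [zero_add] at h
        rw [← Finset.sum_sub_distrib, ← h]
        exact Finset.sum_congr rfl fun i _ => by rw [add_right_comm, add_assoc]
      unfold cesaroAvg
      rw [← sub_div, e, norm_div, Real.norm_eq_abs, Real.norm_natCast]
      refine div_le_div_of_nonneg_right ((abs_sub _ _).trans ?_) n.cast_nonneg
      linarith [hu (n + a), hu a]
    simpa using h.add ih

lemma tendsto_cesaroAvg_shift {u : ℕ → ℝ} {l : ℝ} (hu : ∀ i, |u i| ≤ 1)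
    (h : Tendsto (cesaroAvg u) atTop (𝓝 l)) (a : ℕ) :
    Tendsto (cesaroAvg fun i => u (i + a)) atTop (𝓝 l) := by
  simpa using (tendsto_cesaroAvg_shift_sub hu a).add h

lemma cesaroAvg_sq_le (u : ℕ → ℝ) (n : ℕ) :
    cesaroAvg u n ^ 2 ≤ cesaroAvg (fun i => u i ^ 2) n := by
  unfold cesaroAvg
  rcases Nat.eq_zero_or_pos n with rfl | hn
  · simp
  have hn' : (0 : ℝ) < n := Nat.cast_pos.2 hn
  have h := sq_sum_le_card_mul_sum_sq (s := Finset.range n) (f := u)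
  rw [Finset.card_range] at h
  rw [div_pow, div_le_div_iff₀ (by positivity) hn']
  nlinarith

lemma cesaroAvg_mul_le {u : ℕ → ℝ} (hu : ∀ i, 0 ≤ u i) {m : ℕ} (hm : 0 < m) (n : ℕ) :
    cesaroAvg (fun i => u (m * i)) n ≤ m * cesaroAvg u (m * n) := by
  have hm' : (0 : ℝ) < m := Nat.cast_pos.2 hm
  have h : ∑ i ∈ Finset.range n, u (m * i) ≤ ∑ i ∈ Finset.range (m * n), u i := by
    rw [← Finset.sum_image (f := u) (g := fun i => m * i) (s := Finset.range n)
      fun i _ j _ hij => Nat.eq_of_mul_eq_mul_left hm hij]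
    refine Finset.sum_le_sum_of_subset_of_nonneg (fun j hj => ?_) fun i _ _ => hu i
    obtain ⟨i, hi, rfl⟩ := Finset.mem_image.1 hj
    exact Finset.mem_range.2 (Nat.mul_lt_mul_of_pos_left (Finset.mem_range.1 hi) hm)
  unfold cesaroAvg
  push_cast
  rw [mul_div_mul_left _ _ hm'.ne' |> fun e => (mul_div_assoc _ _ _).symm.trans e]
  exact div_le_div_of_nonneg_right h n.cast_nonneg

/-- If the autocorrelations of a bounded sequence `g` at multiples of `m` exist and tend to `0`,
then `g` has mean `0` along the multiples of `m`. -/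
lemma tendsto_cesaroAvg_mul_zero {g e : ℕ → ℝ} {m : ℕ} (hm : 0 < m) (hg : ∀ i, |g i| ≤ 1)
    (hcor : ∀ d, Tendsto (cesaroAvg fun i => g i * g (i + m * d)) atTop (𝓝 (e d)))
    (he : Tendsto e atTop (𝓝 0)) :
    Tendsto (cesaroAvg fun i => g (m * i)) atTop (𝓝 0) := by
  have hgg : ∀ i j, |g i * g j| ≤ 1 := fun i j => by
    rw [abs_mul]; exact mul_le_one₀ (hg i) (abs_nonneg _) (hg j)
  have he1 : e 0 ≤ 1 := le_of_tendsto' (hcor 0) fun n =>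
    (abs_le.1 (abs_cesaroAvg_le (fun i => hgg _ _) n)).2
  have hm' : (0 : ℝ) < m := Nat.cast_pos.2 hm
  rw [Metric.tendsto_atTop']
  intro δ hδ
  -- Chosen so that m(2K²ε + K²ε/m) = (Kδ/2)².
  set ε : ℝ := (δ / 2) ^ 2 / (2 * m + 1) with hε
  have hε0 : 0 < ε := by positivity
  obtain ⟨D, hD⟩ := (eventually_atTop.1 ((tendsto_order.1 he).2 ε hε0))
  obtain ⟨K, hK⟩ := exists_nat_gt (1 / ε)
  have hK0 : (0 : ℝ) < K := lt_trans (by positivity) hK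
  have hKε : 1 ≤ K * ε := by rw [div_lt_iff₀ hε0] at hK; exact hK.le
  -- The spacing D + 1 puts any two distinct translates at a lag of at least mD, where e is below ε.
  -- The choice K > 1/ε makes the K diagonal terms contribute at most K ≤ K²ε.
  let G : ℕ → ℝ := fun i => ∑ k ∈ Finset.range K, g (i + m * ((D + 1) * k))
  -- With truncated subtraction, (j - k) + (k - j) is |j - k|.
  have hpair : ∀ j k : ℕ, Tendsto (cesaroAvg fun i => g (i + m * ((D + 1) * j)) *
      g (i + m * ((D + 1) * k))) atTop (𝓝 (e ((D + 1) * ((j - k) + (k - j))))) := by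
    have main : ∀ j d : ℕ, Tendsto (cesaroAvg fun i => g (i + m * ((D + 1) * j)) *
        g (i + m * ((D + 1) * (j + d)))) atTop (𝓝 (e ((D + 1) * d))) := by
      intro j d
      have := tendsto_cesaroAvg_shift (fun i => hgg i _) (hcor ((D + 1) * d)) (m * ((D + 1) * j))
      convert this using 3
      ring_nf
    intro j k
    rcases le_total j k with h | h
    · obtain ⟨d, rfl⟩ := Nat.exists_eq_add_of_le h
      convert main j d using 4
      omega
    · obtain ⟨d, rfl⟩ := Nat.exists_eq_add_of_le h
      simp_rw [mul_comm (g (_ + m * ((D + 1) * (k + d))))]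
      convert main k d using 4
      omega
  have hGlim : Tendsto (cesaroAvg fun i => G i ^ 2) atTop
      (𝓝 (∑ j ∈ Finset.range K, ∑ k ∈ Finset.range K, e ((D + 1) * ((j - k) + (k - j))))) := by
    have eG : (cesaroAvg fun i => G i ^ 2) = fun n => ∑ j ∈ Finset.range K,
        ∑ k ∈ Finset.range K, cesaroAvg (fun i => g (i + m * ((D + 1) * j)) *
          g (i + m * ((D + 1) * k))) n := by
      funext n
      simp_rw [← cesaroAvg_sum]
      congr 1
      funext i
      rw [sq, Finset.sum_mul_sum]
    rw [eG]
    exact tendsto_finsetSum _ fun j _ => tendsto_finsetSum _ fun k _ => hpair j k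
  have hlimle : ∑ j ∈ Finset.range K, ∑ k ∈ Finset.range K, e ((D + 1) * ((j - k) + (k - j))) ≤
      K + K ^ 2 * ε := by
    calc _ ≤ ∑ j ∈ Finset.range K, ∑ k ∈ Finset.range K, ((if j = k then 1 else 0) + ε) := by
          refine Finset.sum_le_sum fun j _ => Finset.sum_le_sum fun k _ => ?_
          split_ifs with h
          · subst h; simp; linarith
          · rw [zero_add]
            have h1 : 1 ≤ (j - k) + (k - j) := by omega
            exact (hD _ (by nlinarith)).le
      _ ≤ _ := by
          simp only [Finset.sum_add_distrib, Finset.sum_ite_eq, Finset.sum_const,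
            Finset.card_range, nsmul_eq_mul]
          refine add_le_add ?_ (by rw [sq, mul_assoc])
          refine (Finset.sum_le_sum (g := fun _ => (1 : ℝ)) fun j _ => ?_).trans (by simp)
          split_ifs <;> norm_num
  have hGev : ∀ᶠ n in atTop, cesaroAvg (fun i => G i ^ 2) (m * n) < 2 * K ^ 2 * ε + K ^ 2 * ε / m := by
    have hmul : Tendsto (fun n => m * n) atTop atTop := tendsto_id.const_mul_atTop' hm
    refine (hGlim.comp hmul).eventually (gt_mem_nhds ?_)
    have h1 : 0 < K ^ 2 * ε / m := by positivity
    have h2 : (K : ℝ) ≤ K ^ 2 * ε := by nlinarith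
    linarith
  have hdiff : Tendsto (fun n => cesaroAvg (fun i => G (m * i)) n -
      K * cesaroAvg (fun i => g (m * i)) n) atTop (𝓝 0) := by
    have h := tendsto_finsetSum (Finset.range K) fun k _ =>
      tendsto_cesaroAvg_shift_sub (u := fun i => g (m * i)) (fun i => hg _) ((D + 1) * k)
    rw [Finset.sum_const_zero] at h
    convert h using 2 with n
    rw [Finset.sum_sub_distrib, ← cesaroAvg_sum]
    simp [G, mul_add]
  have hdev : ∀ᶠ n in atTop, |cesaroAvg (fun i => G (m * i)) n -
      K * cesaroAvg (fun i => g (m * i)) n| < K * (δ / 2) := by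
    have := hdiff.abs
    rw [abs_zero] at this
    exact this.eventually (gt_mem_nhds (by positivity))
  obtain ⟨N, hN⟩ := eventually_atTop.1 (hGev.and hdev)
  refine ⟨N, fun n hn => ?_⟩
  obtain ⟨h1, h2⟩ := hN n (le_of_lt hn)
  rw [dist_zero_right, Real.norm_eq_abs]
  have h3 : cesaroAvg (fun i => G (m * i)) n ^ 2 ≤ (K * (δ / 2)) ^ 2 := by
    calc _ ≤ cesaroAvg (fun i => G (m * i) ^ 2) n := cesaroAvg_sq_le _ n
      _ ≤ m * cesaroAvg (fun i => G i ^ 2) (m * n) :=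
          cesaroAvg_mul_le (u := fun i => G i ^ 2) (fun i => sq_nonneg _) hm n
      _ ≤ m * (2 * K ^ 2 * ε + K ^ 2 * ε / m) := by gcongr
      _ = K ^ 2 * ((2 * m + 1) * ε) := by field_simp
      _ = _ := by rw [hε, mul_div_cancel₀ _ (by positivity)]; ring
  have h4 := abs_le.1 (abs_le_of_sq_le_sq h3 (by positivity))
  have h5 : |K * cesaroAvg (fun i => g (m * i)) n| < K * δ := by
    rw [abs_lt]; rw [abs_lt] at h2; constructor <;> linarith [h4.1, h4.2, h2.1, h2.2]
  rw [abs_mul, Nat.abs_cast] at h5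
  exact lt_of_mul_lt_mul_left h5 hK0.le

/-- If the autocorrelations of a sequence `f` in `[0, 1]` at multiples of `m` exist and tend to the square of its mean,
then `f` has the same mean along the multiples of `m`. -/
lemma tendsto_cesaroAvg_mul {f c : ℕ → ℝ} {p : ℝ} {m : ℕ} (hm : 0 < m)
    (hf0 : ∀ i, 0 ≤ f i) (hf1 : ∀ i, f i ≤ 1) (hp : Tendsto (cesaroAvg f) atTop (𝓝 p))
    (hcor : ∀ d, Tendsto (cesaroAvg fun i => f i * f (i + m * d)) atTop (𝓝 (c d)))
    (hc : Tendsto c atTop (𝓝 (p ^ 2))) :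
    Tendsto (cesaroAvg fun i => f (m * i)) atTop (𝓝 p) := by
  have hf : ∀ i, |f i| ≤ 1 := fun i => by rw [abs_of_nonneg (hf0 i)]; exact hf1 i
  have hpb : 0 ≤ p ∧ p ≤ 1 := by
    refine ⟨ge_of_tendsto' hp fun n => ?_, le_of_tendsto' hp fun n =>
      (abs_le.1 (abs_cesaroAvg_le hf n)).2⟩
    exact div_nonneg (Finset.sum_nonneg fun i _ => hf0 i) n.cast_nonneg
  have hconst : ∀ (u : ℕ → ℝ) (b : ℝ), ∀ n ≠ 0,
      cesaroAvg (fun i => u i - b) n = cesaroAvg u n - b := by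
    intro u b n hn
    have : (n : ℝ) ≠ 0 := Nat.cast_ne_zero.2 hn
    unfold cesaroAvg
    rw [Finset.sum_sub_distrib, sub_div]
    simp [this]
  have hmain := tendsto_cesaroAvg_mul_zero (g := fun i => f i - p) (e := fun d => c d - p ^ 2) hm
    (fun i => abs_le.2 ⟨by linarith [hf0 i], by linarith [hf1 i]⟩) (fun d => ?_)
    (by have h := hc.sub_const (p ^ 2); rwa [sub_self] at h)
  · have := hmain.add_const p
    rw [zero_add] at this
    refine this.congr' ?_
    filter_upwards [eventually_ne_atTop 0] with n hn
    rw [hconst (fun i => f (m * i)) p n hn]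
    ring
  · have h := (((hcor d).sub (hp.const_mul p)).sub
      ((tendsto_cesaroAvg_shift hf hp (m * d)).const_mul p)).add_const (p ^ 2)
    have e : c d - p * p - p * p + p ^ 2 = c d - p ^ 2 := by ring
    rw [e] at h
    refine h.congr' ?_
    filter_upwards [eventually_ne_atTop 0] with n hn
    have hn' : (n : ℝ) ≠ 0 := Nat.cast_ne_zero.2 hn
    have e2 : ∀ i, (f i - p) * (f (i + m * d) - p) =
        f i * f (i + m * d) - p * f i - p * f (i + m * d) + p ^ 2 := fun i => by ring
    unfold cesaroAvg
    simp_rw [e2]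
    rw [Finset.sum_add_distrib, Finset.sum_sub_distrib, Finset.sum_sub_distrib,
      ← Finset.mul_sum, ← Finset.mul_sum]
    simp
    field_simp

/-! ### From cylinders to sets determined by finitely many digits -/

/-- If the frequencies of a sequence in a countable space converge to a probability measure at every atom,
they converge on every set. -/
lemma tendsto_cesaroAvg_indicator {ι : Type*} [Countable ι] [MeasurableSpace ι]
    [MeasurableSingletonClass ι] (ν : Measure ι) [IsProbabilityMeasure ν] (y : ℕ → ι)
    (h : ∀ v, ν.real {v} = 0 ∨
      Tendsto (cesaroAvg fun i => ({v} : Set ι).indicator 1 (y i)) atTop (𝓝 (ν.real {v})))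
    (S : Set ι) :
    Tendsto (cesaroAvg fun i => S.indicator 1 (y i)) atTop (𝓝 (ν.real S)) := by
  classical
  -- Finitely many atoms carry almost all the mass of S, which bounds the frequency from below. The
  -- same bound for the complement gives the upper one, since ν has mass 1.
  have lower : ∀ (S : Set ι) (b : ℝ), b < ν.real S →
      ∀ᶠ n in atTop, b < cesaroAvg (fun i => S.indicator 1 (y i)) n := by
    intro S b hb
    have hsum : HasSum (fun v : S => ν.real {(v : ι)}) (ν.real S) := by
      have hm : ν S = ∑' v : S, ν {(v : ι)} := by
        rw [← measure_iUnion (fun i j hij => by simpa [Subtype.ext_iff] using hij)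
          fun v => measurableSet_singleton _]
        congr 1
        simp
      have := ENNReal.hasSum_toReal (f := fun v : S => ν {(v : ι)})
        (by rw [← hm]; exact measure_ne_top _ _)
      rwa [← ENNReal.tsum_toReal_eq fun v => measure_ne_top _ _, ← hm] at this
    obtain ⟨F, hF⟩ := ((tendsto_order.1 hsum).1 b hb).exists
    -- Null atoms are dropped: their frequencies are not assumed to converge.
    have hlim : Tendsto (fun n => ∑ v ∈ F.filter (fun v : S => ν.real {(v : ι)} ≠ 0),
        cesaroAvg (fun i => ({(v : ι)} : Set ι).indicator 1 (y i)) n) atTop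
        (𝓝 (∑ v ∈ F, ν.real {(v : ι)})) := by
      rw [← Finset.sum_filter_ne_zero F]
      exact tendsto_finsetSum _ fun v hv => (h v).resolve_left (Finset.mem_filter.1 hv).2
    filter_upwards [hlim.eventually (lt_mem_nhds hF)] with n hn
    refine hn.trans_le ?_
    rw [← cesaroAvg_sum]
    unfold cesaroAvg
    refine div_le_div_of_nonneg_right (Finset.sum_le_sum fun i _ => ?_) n.cast_nonneg
    by_cases hi : y i ∈ S
    · rw [Set.indicator_of_mem hi]
      calc _ ≤ ∑ v ∈ F, ({(v : ι)} : Set ι).indicator (1 : ι → ℝ) (y i) :=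
            Finset.sum_le_sum_of_subset_of_nonneg (Finset.filter_subset _ _) fun v _ _ =>
              Set.indicator_nonneg (fun _ _ => zero_le_one) _
        _ = ∑ v ∈ F, if v = ⟨y i, hi⟩ then 1 else 0 := by
            refine Finset.sum_congr rfl fun v _ => ?_
            simp [Set.indicator_apply, Subtype.ext_iff, eq_comm]
        _ ≤ _ := by
            rw [Finset.sum_ite_eq']
            rw [Pi.one_apply]
            split_ifs <;> norm_num
    · rw [Set.indicator_of_notMem hi]
      refine (Finset.sum_eq_zero fun v _ => ?_).le
      refine Set.indicator_of_notMem (fun hv => hi ?_) _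
      rw [Set.mem_singleton_iff.1 hv]
      exact v.2
  rw [tendsto_order]
  refine ⟨fun b hb => lower S b hb, fun b hb => ?_⟩
  have hc : ν.real Sᶜ = 1 - ν.real S := probReal_compl_eq_one_sub S.to_countable.measurableSet
  filter_upwards [lower Sᶜ (1 - b) (by linarith), eventually_ne_atTop 0] with n hn hn0
  have hn0' : (n : ℝ) ≠ 0 := Nat.cast_ne_zero.2 hn0
  have e : cesaroAvg (fun i => S.indicator 1 (y i)) n +
      cesaroAvg (fun i => Sᶜ.indicator 1 (y i)) n = 1 := by
    unfold cesaroAvg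
    rw [← add_div, ← Finset.sum_add_distrib, div_eq_one_iff_eq hn0',
      Finset.sum_congr rfl fun i _ => Set.indicator_self_add_compl_apply S (1 : ι → ℝ) (y i)]
    simp
  linarith

/-- The first `n` partial quotients. -/
noncomputable def cfPrefix (n : ℕ) (x : ℝ) : Fin n → ℕ := fun i => cfDigit x i

lemma measurable_cfPrefix (n : ℕ) : Measurable (cfPrefix n) :=
  measurable_pi_lambda _ fun i => measurable_cfDigit i

lemma mem_cfCylinder_ofFn {n : ℕ} {v : Fin n → ℕ+} {x : ℝ} :
    x ∈ cfCylinder (List.ofFn v) ↔ x ∈ Set.Icc (0 : ℝ) 1 ∧ cfPrefix n x = fun i => (v i : ℕ) := by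
  refine and_congr_right fun _ => ⟨fun h => funext fun i => ?_, fun h i hi => ?_⟩
  · have := h i (by simp)
    rwa [List.getElem_ofFn] at this
  · rw [List.getElem_ofFn]
    exact congr_fun h ⟨i, by simpa using hi⟩

lemma tendsto_cesaroAvg_slidingCount {x l : ℝ} {s : List ℕ+}
    (h : Tendsto (fun n : ℕ => (slidingCount x s n : ℝ) / (n : ℝ)) atTop (𝓝 l)) :
    Tendsto (cesaroAvg fun i => (cfCylinder s).indicator 1 (gaussMap^[i] x)) atTop (𝓝 l) := by
  classical
  -- The count runs over the n + 1 positions 0, …, n but is divided by n.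
  rw [← tendsto_add_atTop_iff_nat 1]
  have h' := h.mul (tendsto_natCast_div_add_atTop (1 : ℝ))
  rw [mul_one] at h'
  refine h'.congr' ?_
  filter_upwards [eventually_ne_atTop 0] with n hn
  have hn' : (n : ℝ) ≠ 0 := Nat.cast_ne_zero.2 hn
  have e : (slidingCount x s n : ℝ) =
      ∑ i ∈ Finset.range (n + 1), (cfCylinder s).indicator 1 (gaussMap^[i] x) := by
    have : {i : ℕ | i ≤ n ∧ gaussMap^[i] x ∈ cfCylinder s} =
        ((Finset.range (n + 1)).filter fun i => gaussMap^[i] x ∈ cfCylinder s : Finset ℕ) := by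
      ext i; simp
    rw [slidingCount, this, Set.ncard_coe_finset, Finset.card_filter]
    push_cast
    exact Finset.sum_congr rfl fun i _ => by simp [Set.indicator_apply]
  rw [cesaroAvg, ← e]
  push_cast
  field_simp

lemma tendsto_disjointCount {x l : ℝ} {t : List ℕ+} (ht : t ≠ [])
    (h : Tendsto (cesaroAvg fun i => (cfCylinder t).indicator 1 (gaussMap^[t.length * i] x))
      atTop (𝓝 l)) :
    Tendsto (fun n : ℕ => (disjointCount x t n : ℝ) / ((n : ℝ) / (t.length : ℝ))) atTop
      (𝓝 l) := by
  classical
  have hm : 0 < t.length := List.length_pos_of_ne_nil ht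
  have hm' : (0 : ℝ) < t.length := Nat.cast_pos.2 hm
  have hq : Tendsto (fun n : ℕ => n / t.length + 1) atTop atTop :=
    (tendsto_add_atTop_nat 1).comp (Nat.tendsto_div_const_atTop hm.ne')
  -- The blocks counted number ⌊n/m⌋ + 1, while the divisor is the real n/m.
  have hratio : Tendsto (fun n : ℕ => ((n / t.length + 1 : ℕ) : ℝ) / ((n : ℝ) / (t.length : ℝ)))
      atTop (𝓝 1) := by
    have hup : Tendsto (fun n : ℕ => 1 + (t.length : ℝ) / n) atTop (𝓝 1) := by
      simpa using (tendsto_const_div_atTop_nhds_zero_nat (t.length : ℝ)).const_add 1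
    refine tendsto_of_tendsto_of_tendsto_of_le_of_le' tendsto_const_nhds hup ?_ ?_
    · filter_upwards [eventually_gt_atTop 0] with n hn
      have hn' : (0 : ℝ) < n := Nat.cast_pos.2 hn
      rw [one_le_div (by positivity), div_le_iff₀ hm']
      exact_mod_cast (Nat.lt_div_mul_add hm (a := n)).le.trans (by rw [Nat.add_mul, one_mul])
    · filter_upwards [eventually_gt_atTop 0] with n hn
      have hn' : (0 : ℝ) < n := Nat.cast_pos.2 hn
      rw [div_le_iff₀ (by positivity)]
      push_cast
      have e : (1 + (t.length : ℝ) / n) * (n / t.length) = n / t.length + 1 := by field_simp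
      rw [e]
      exact add_le_add_left Nat.cast_div_le 1
  have := (h.comp hq).mul hratio
  rw [mul_one] at this
  refine this.congr fun n => ?_
  have e : (disjointCount x t n : ℝ) = ∑ i ∈ Finset.range (n / t.length + 1),
      (cfCylinder t).indicator 1 (gaussMap^[t.length * i] x) := by
    have : {i : ℕ | (i : ℝ) ≤ (n : ℝ) / (t.length : ℝ) ∧
        gaussMap^[t.length * i] x ∈ cfCylinder t} =
        ((Finset.range (n / t.length + 1)).filter fun i =>
          gaussMap^[t.length * i] x ∈ cfCylinder t : Finset ℕ) := by
      ext i
      simp only [Finset.coe_filter, Finset.mem_range, Set.mem_ofPred_eq, Nat.lt_succ_iff]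
      rw [le_div_iff₀ hm', Nat.le_div_iff_mul_le hm]
      norm_cast
    rw [disjointCount, this, Set.ncard_coe_finset, Finset.card_filter]
    push_cast
    exact Finset.sum_congr rfl fun i _ => by simp [Set.indicator_apply]
  have h0 : ((n / t.length + 1 : ℕ) : ℝ) ≠ 0 := Nat.cast_ne_zero.2 (Nat.succ_ne_zero _)
  rw [Function.comp_apply, cesaroAvg, ← e, div_mul_div_cancel₀ h0]

/-- For a continued fraction normal number, the frequency of a set that is determined by finitely many
partial quotients is its Gauss measure. -/
lemma tendsto_cesaroAvg_cfPrefix {x : ℝ} (hx : x ∈ Set.Icc (0 : ℝ) 1)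
    (hnormal : ∀ s : List ℕ+, s ≠ [] →
      Tendsto (fun n : ℕ => (slidingCount x s n : ℝ) / (n : ℝ)) atTop
        (𝓝 (gaussMeasure.real (cfCylinder s)))) {n : ℕ} (hn : 0 < n) (S : Set (Fin n → ℕ)) :
    Tendsto (cesaroAvg fun i => S.indicator 1 (cfPrefix n (gaussMap^[i] x))) atTop
      (𝓝 (gaussMeasure.real (cfPrefix n ⁻¹' S))) := by
  have hprob : IsProbabilityMeasure (gaussMeasure.map (cfPrefix n)) :=
    Measure.isProbabilityMeasure_map (measurable_cfPrefix n).aemeasurable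
  have hmap : ∀ S : Set (Fin n → ℕ), (gaussMeasure.map (cfPrefix n)).real S =
      gaussMeasure.real (cfPrefix n ⁻¹' S) := fun S =>
    map_measureReal_apply (measurable_cfPrefix n) S.to_countable.measurableSet
  rw [← hmap]
  refine tendsto_cesaroAvg_indicator _ _ (fun v => ?_) S
  rw [hmap]
  by_cases hv : ∀ i, 0 < v i
  · right
    let w : Fin n → ℕ+ := fun i => ⟨v i, hv i⟩
    have hw : List.ofFn w ≠ [] := by
      rw [← List.length_pos_iff, List.length_ofFn]; exact hn
    have h := tendsto_cesaroAvg_slidingCount (hnormal _ hw)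
    have e : gaussMeasure.real (cfPrefix n ⁻¹' {v}) = gaussMeasure.real (cfCylinder (List.ofFn w)) := by
      refine measureReal_congr ?_
      filter_upwards [ae_gaussMeasure_mem_Icc] with y hy
      refine propext ?_
      exact ⟨fun h => mem_cfCylinder_ofFn.2 ⟨hy, h⟩, fun h => (mem_cfCylinder_ofFn.1 h).2⟩
    rw [e]
    convert h using 3 with i
    have hi : cfPrefix n (gaussMap^[i] x) ∈ ({v} : Set (Fin n → ℕ)) ↔
        gaussMap^[i] x ∈ cfCylinder (List.ofFn w) :=
      ⟨fun h => mem_cfCylinder_ofFn.2 ⟨gaussMap_iterate_mem hx i, h⟩,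
        fun h => (mem_cfCylinder_ofFn.1 h).2⟩
    by_cases h : gaussMap^[i] x ∈ cfCylinder (List.ofFn w)
    · rw [Set.indicator_of_mem h, Set.indicator_of_mem (hi.2 h)]; rfl
    · rw [Set.indicator_of_notMem h, Set.indicator_of_notMem (mt hi.1 h)]
  -- A digit 0 marks an expansion that has ended; this happens on a null set, and normality says
  -- nothing about it.
  · left
    push Not at hv
    obtain ⟨i, hi⟩ := hv
    rw [measureReal_eq_zero_iff, measure_eq_zero_iff_ae_notMem]
    filter_upwards [ae_gaussMeasure_cfDigit_pos] with y hy hyv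
    have : cfDigit y i = v i := congr_fun (Set.mem_singleton_iff.1 hyv) i
    have := hy i
    omega

/-! ### The theorem -/

theorem mainTheorem2 (x : ℝ) (hx : x ∈ Set.Ioo (0 : ℝ) 1)
    (hnormal : ∀ s : List ℕ+, s ≠ [] →
      Tendsto (fun n : ℕ => (slidingCount x s n : ℝ) / (n : ℝ)) atTop
        (𝓝 (gaussMeasure.real (cfCylinder s)))) :
    ∀ t : List ℕ+, t ≠ [] →
      Tendsto (fun n : ℕ => (disjointCount x t n : ℝ) / ((n : ℝ) / (t.length : ℝ))) atTop
        (𝓝 (gaussMeasure.real (cfCylinder t))) := by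
  intro t ht
  have hx' : x ∈ Set.Icc (0 : ℝ) 1 := ⟨hx.1.le, hx.2.le⟩
  have hm : 0 < t.length := List.length_pos_of_ne_nil ht
  refine tendsto_disjointCount ht ?_
  refine tendsto_cesaroAvg_mul (f := fun i => (cfCylinder t).indicator 1 (gaussMap^[i] x))
    (c := fun d => gaussMeasure.real (cfCylinder t ∩ gaussMap^[t.length * d] ⁻¹' cfCylinder t)) hm
    (fun i => Set.indicator_nonneg (fun _ _ => zero_le_one) _)
    (fun i => Set.indicator_le_self' (fun _ _ => zero_le_one) _)
    (tendsto_cesaroAvg_slidingCount (hnormal t ht)) (fun d => ?_) ?_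
  -- The digits between the two copies of t are free, so S is in general an infinite set of strings;
  -- this is why frequencies of infinite unions of cylinders are needed.
  · let S : Set (Fin (t.length * d + t.length) → ℕ) := {v | ∀ (j : ℕ) (hj : j < t.length),
      v ⟨j, by omega⟩ = t[j] ∧ v ⟨t.length * d + j, by omega⟩ = t[j]}
    have hS : ∀ y ∈ Set.Icc (0 : ℝ) 1, cfPrefix (t.length * d + t.length) y ∈ S ↔
        y ∈ cfCylinder t ∧ gaussMap^[t.length * d] y ∈ cfCylinder t := by
      intro y hy
      have hy' := gaussMap_iterate_mem hy (t.length * d)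
      simp only [S, cfCylinder, Set.mem_ofPred_eq, cfPrefix, cfDigit_iterate, hy, hy', true_and]
      exact ⟨fun h => ⟨fun j hj => (h j hj).1, fun j hj => (h j hj).2⟩,
        fun h j hj => ⟨h.1 j hj, h.2 j hj⟩⟩
    have h := tendsto_cesaroAvg_cfPrefix hx' hnormal (n := t.length * d + t.length) (by omega) S
    have e : gaussMeasure.real (cfPrefix (t.length * d + t.length) ⁻¹' S) =
        gaussMeasure.real (cfCylinder t ∩ gaussMap^[t.length * d] ⁻¹' cfCylinder t) := by
      refine measureReal_congr ?_
      filter_upwards [ae_gaussMeasure_mem_Icc] with y hy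
      exact propext (hS y hy)
    rw [e] at h
    convert h using 3 with i
    have hi := hS _ (gaussMap_iterate_mem hx' i)
    rw [← Function.iterate_add_apply, add_comm (t.length * d) i] at hi
    by_cases h1 : gaussMap^[i] x ∈ cfCylinder t <;>
      by_cases h2 : gaussMap^[i + t.length * d] x ∈ cfCylinder t <;>
      simp [hi, h1, h2]
  · rw [sq]
    exact (tendsto_gaussMeasure_cfCylinder_inter t (measurableSet_cfCylinder t)).comp
      (tendsto_id.const_mul_atTop' hm)
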